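/- **Setting.** Let $\mathcal L$ be a countable one-sorted relational language of continuous logic (logic for metric structures) with domains of quantification $(D_n)_{n\in\mathbb N}$. It consists of the metric symbol $d$ and countably many relation symbols $B$ of finite arity $|B|$. For every choice of domains for the arguments, the language specifies a bound for each symbol and a uniform continuity modulus for each $B$: a function $\Delta$, positive on $(0,\infty)$, such that for $\varepsilon>0$, $\max_i d(x_i,y_i)<\Delta(\varepsilon)$ implies $|B(\bar x)-B(\bar y)|\le\varepsilon$ on those domains. An $\mathcal L$-structure $M$ is a metric space covered by nonempty complete subsets $D_n^M$, with interpretations $B^M:M^{|B|}\to\mathbb R$ that obey the specified bounds and moduli on the domains; $d^M$ is the metric and obeys its bounds. $M$ is *proper* if every $D_n^M$ is compact. An isomorphism $M\to N$ is a surjective isometry that maps $D_n^M$ onto $D_n^N$ for each $n$ and preserves all relations. **Parametrization.** Fix infinite sets $Q_0\subseteq Q_1\subseteq\cdots$ with $\bigcup_n Q_n=\mathbb N$ and every $Q_{n+1}\setminus Q_n$ infinite. A point $f=(f_B)_B$ of $\prod_B\mathbb R^{\mathbb N^{|B|}}$ (where $B$ ranges over all symbols, including $d$, with $|d|=2$)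 is a *code* if $f_d$ is a pseudometric on $\mathbb N$ and the bounds and moduli of $\mathcal L$ hold for $f$ with $Q_n$ in place of $D_n$. It codes the structure $M_f$ in which $D_n^{M_f}$ is the closure of $Q_n$ in the completion of $(\mathbb N,f_d)$, the underlying space is $\bigcup_n D_n^{M_f}$, and $B$ is interpreted by extending $f_B$ by continuity on the domains. Let $\mathrm{Mod}_p(\mathcal L)$ be the set of codes of proper structures. **Sentences.** Formulas are built from the atomic formulas $d(x,y)$ and $B(\bar x)$ by the quantifiers $\sup_{x\in D_n}$, $\inf_{x\in D_n}$ and by connectives, which are continuous functions $[-b,b]^k\to[-b,b]$ ($b,k\in\mathbb N$), applied only to formulas whose bound, as determined by the language, is at most $b$. For all $b,k$ fix a countable set $\mathcal F_{b,k}$ of continuous functions $[-b,b]^k\to[-b,b]$ that is dense, in the uniform metric, in the set of all of them. A formula is *restricted* if all its connectives come from these sets, and *universal* if it uses no quantifier other than $\sup$; it is *prenex* universal if it is a block of quantifiers $\sup$ followed by a quantifier-free formula. **Statement.** The set of all codes and its subset $\mathrm{Mod}_p(\mathcal L)$ are Borel in $\prod_B\mathbb R^{\mathbb N^{|B|}}$.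 The isomorphism relation $f\sim g\iff M_f\cong M_g$ on the standard Borel space $\mathrm{Mod}_p(\mathcal L)$ is smooth, that is, it is an equivalence relation that is Borel reducible to equality on $\mathbb R$. Moreover, the set of restricted universal sentences is nonempty and countable, and for every enumeration $(\varphi_n)_{n\in\mathbb N}$ of it the map $f\mapsto(\varphi_n^{M_f})_{n\in\mathbb N}$ from $\mathrm{Mod}_p(\mathcal L)$ to $\mathbb R^{\mathbb N}$ is Borel and satisfies $M_f\cong M_g\iff\varphi_n^{M_f}=\varphi_n^{M_g}$ for all $n$. The same holds for the set of restricted prenex universal sentences. -/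

import Mathlib

universe u v

/-! ## Equivalence relations and Borel reductions -/

/-- `f` is a Borel reduction from the relation `E` on `X` to the relation `F` on `Y`. -/
def IsBorelReduction {X : Type u} {Y : Type v} [MeasurableSpace X] [MeasurableSpace Y]
    (E : X → X → Prop) (F : Y → Y → Prop) (f : X → Y) : Prop :=
  Measurable f ∧ ∀ x x', E x x' ↔ F (f x) (f x')

/-- A relation is smooth if it is an equivalence relation on a standard Borel space that is
Borel reducible to equality of real numbers. -/
def IsSmooth {X : Type u} [MeasurableSpace X] (E : X → X → Prop) : Prop :=
  StandardBorelSpace X ∧ Equivalence E ∧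
    ∃ f : X → ℝ, IsBorelReduction E (fun a b : ℝ => a = b) f

/-! ## Languages and structures -/

/-- A one-sorted relational language of the logic for metric structures, with domains of
quantification `D 0, D 1, …`. Besides the symbols in `Rel` there is always the metric symbol.
For every relation symbol and every choice of a domain for each argument, the language specifies
a uniform continuity modulus and a bound; it also specifies bounds for the metric. -/
structure MetricLanguage where
  Rel : Type u
  arity : Rel → ℕ
  modulus : (R : Rel) → (Fin (arity R) → ℕ) → ℝ → ℝ
  modulus_pos : ∀ R D ε, 0 < ε → 0 < modulus R D ε
  bound : (R : Rel) → (Fin (arity R) → ℕ) → ℝ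
  distBound : ℕ → ℕ → ℝ

/-- An `L`-structure: a metric space that is covered by nonempty complete subsets, the
interpretations of the domains of quantification, with a real-valued interpretation of each
relation symbol that obeys the bounds and uniform continuity moduli on the domains. -/
structure MetricStructure (L : MetricLanguage.{u}) where
  carrier : Type v
  [metric : MetricSpace carrier]
  dom : ℕ → Set carrier
  dom_nonempty : ∀ n, (dom n).Nonempty
  dom_complete : ∀ n, IsComplete (dom n)
  dom_cover : ∀ x, ∃ n, x ∈ dom n
  rel : (R : L.Rel) → (Fin (L.arity R) → carrier) → ℝ
  dist_le : ∀ m n x y, x ∈ dom m → y ∈ dom n → dist x y ≤ L.distBound m n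
  rel_le : ∀ R D x, (∀ i, x i ∈ dom (D i)) → |rel R x| ≤ L.bound R D
  rel_modulus : ∀ R D x y, (∀ i, x i ∈ dom (D i)) → (∀ i, y i ∈ dom (D i)) →
    ∀ ε, 0 < ε → (∀ i, dist (x i) (y i) < L.modulus R D ε) → |rel R x - rel R y| ≤ ε

attribute [instance] MetricStructure.metric

namespace MetricStructure

/-- A structure is proper if the interpretation of every domain of quantification is compact. -/
def IsProper {L : MetricLanguage.{u}} (M : MetricStructure.{u, v} L) : Prop :=
  ∀ n, IsCompact (M.dom n)

/-- Isomorphism: a surjective isometry that matches the domains and the relations. -/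
def Isomorphic {L : MetricLanguage.{u}} (M N : MetricStructure.{u, v} L) : Prop :=
  ∃ e : M.carrier ≃ᵢ N.carrier, (∀ n, e '' M.dom n = N.dom n) ∧
    ∀ R x, N.rel R (fun i => e (x i)) = M.rel R x

end MetricStructure

/-! ## Formulas -/

/-- Connectives: continuous functions from `[-b, b]^k` to `[-b, b]`. -/
abbrev Connective (b k : ℕ) : Type :=
  C(Fin k → Set.Icc (-(b : ℝ)) (b : ℝ), Set.Icc (-(b : ℝ)) (b : ℝ))

/-- `L`-formulas in the free variables `x 0, …, x (n - 1)`. The quantified formulas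
`sup D φ` and `inf D φ` stand for the supremum and the infimum of `φ` over `x n ∈ D`. -/
inductive MetricFormula (L : MetricLanguage.{u}) : ℕ → Type u
  | dist {n : ℕ} (i j : Fin n) : MetricFormula L n
  | rel {n : ℕ} (R : L.Rel) (w : Fin (L.arity R) → Fin n) : MetricFormula L n
  | conn {n : ℕ} (b k : ℕ) (f : Connective b k) (φ : Fin k → MetricFormula L n) :
      MetricFormula L n
  | sup {n : ℕ} (D : ℕ) (φ : MetricFormula L (n + 1)) : MetricFormula L n
  | inf {n : ℕ} (D : ℕ) (φ : MetricFormula L (n + 1)) : MetricFormula L n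

namespace MetricFormula

variable {L : MetricLanguage.{u}}

/-- The bound that the language gives for the absolute value of a formula when its `i`-th free
variable ranges over the domain `Γ i`. -/
def bound : {n : ℕ} → (Fin n → ℕ) → MetricFormula L n → ℝ
  | _, Γ, dist i j => L.distBound (Γ i) (Γ j)
  | _, Γ, rel R w => L.bound R (fun i => Γ (w i))
  | _, _, conn b _ _ _ => b
  | _, Γ, sup D φ => φ.bound (Fin.snoc (α := fun _ => ℕ) Γ D)
  | _, Γ, inf D φ => φ.bound (Fin.snoc (α := fun _ => ℕ) Γ D)

/-- A connective on `[-b, b]^k` may be applied only to formulas that are bounded by `b`. -/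
def WellFormed : {n : ℕ} → (Fin n → ℕ) → MetricFormula L n → Prop
  | _, _, dist _ _ => True
  | _, _, rel _ _ => True
  | _, Γ, conn b _ _ φ => ∀ i, (φ i).bound Γ ≤ b ∧ (φ i).WellFormed Γ
  | _, Γ, sup D φ => φ.WellFormed (Fin.snoc (α := fun _ => ℕ) Γ D)
  | _, Γ, inf D φ => φ.WellFormed (Fin.snoc (α := fun _ => ℕ) Γ D)

/-- The value of a formula in a structure. In a well-formed formula, the projection to `[-b, b]`
is only applied to values that lie in `[-b, b]` already, where it is the identity. -/
noncomputable def value (M : MetricStructure.{u, v} L) :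
    {n : ℕ} → MetricFormula L n → (Fin n → M.carrier) → ℝ
  | _, dist i j, x => Dist.dist (x i) (x j)
  | _, rel R w, x => M.rel R (fun i => x (w i))
  | _, conn b _ f φ, x =>
      f (fun i => Set.projIcc (-(b : ℝ)) (b : ℝ) (by simp) ((φ i).value M x))
  | _, sup D φ, x => ⨆ a : M.dom D, φ.value M (Fin.snoc (α := fun _ => M.carrier) x a.1)
  | _, inf D φ, x => ⨅ a : M.dom D, φ.value M (Fin.snoc (α := fun _ => M.carrier) x a.1)

/-- A formula is universal if it uses no quantifier other than `sup`. -/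
def IsUniversal : {n : ℕ} → MetricFormula L n → Prop
  | _, dist _ _ => True
  | _, rel _ _ => True
  | _, conn _ _ _ φ => ∀ i, (φ i).IsUniversal
  | _, sup _ φ => φ.IsUniversal
  | _, inf _ _ => False

def IsQuantifierFree : {n : ℕ} → MetricFormula L n → Prop
  | _, dist _ _ => True
  | _, rel _ _ => True
  | _, conn _ _ _ φ => ∀ i, (φ i).IsQuantifierFree
  | _, sup _ _ => False
  | _, inf _ _ => False

/-- Prenex universal formulas: a block of quantifiers `sup` before a quantifier-free formula. -/
def IsPrenexUniversal : {n : ℕ} → MetricFormula L n → Prop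
  | _, sup _ φ => φ.IsPrenexUniversal
  | _, φ => φ.IsQuantifierFree

/-- A formula is restricted (with respect to `F`) if all its connectives come from `F`. -/
def IsRestricted (F : (b k : ℕ) → Set (Connective b k)) : {n : ℕ} → MetricFormula L n → Prop
  | _, dist _ _ => True
  | _, rel _ _ => True
  | _, conn b k f φ => f ∈ F b k ∧ ∀ i, (φ i).IsRestricted F
  | _, sup _ φ => φ.IsRestricted F
  | _, inf _ φ => φ.IsRestricted F

end MetricFormula

/-- Uniform density of a family of connectives in the continuous functions
from `[-b, b]^k` to `[-b, b]`, for all `b` and `k`. -/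
def UniformlyDense (F : (b k : ℕ) → Set (Connective b k)) : Prop :=
  ∀ b k, ∀ g : Connective b k, ∀ ε : ℝ, 0 < ε →
    ∃ f ∈ F b k, ∀ t, |(f t : ℝ) - (g t : ℝ)| < ε

/-- The restricted universal sentences. -/
def restrictedUniversalSentences (L : MetricLanguage.{u})
    (F : (b k : ℕ) → Set (Connective b k)) : Set (MetricFormula L 0) :=
  {φ | φ.WellFormed Fin.elim0 ∧ φ.IsRestricted F ∧ φ.IsUniversal}

/-- The restricted universal sentences in prenex form. -/
def restrictedPrenexUniversalSentences (L : MetricLanguage.{u})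
    (F : (b k : ℕ) → Set (Connective b k)) : Set (MetricFormula L 0) :=
  {φ | φ.WellFormed Fin.elim0 ∧ φ.IsRestricted F ∧ φ.IsPrenexUniversal}

/-- The value of a sentence in a structure. -/
noncomputable def MetricStructure.sentenceValue {L : MetricLanguage.{u}}
    (M : MetricStructure.{u, v} L) (φ : MetricFormula L 0) : ℝ :=
  φ.value M (fun i => i.elim0)

/-! ## The parametrization of separable structures -/

/-- An increasing sequence of infinite sets with union `ℕ` and with infinite successive
differences. -/
structure Exhaustion where
  Q : ℕ → Set ℕ
  mono : Monotone Q
  iUnion_eq : ⋃ n, Q n = Set.univ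
  infinite : ∀ n, (Q n).Infinite
  diff_infinite : ∀ n, (Q (n + 1) \ Q n).Infinite

/-- The product over all symbols of `L`, the first factor belonging to the metric symbol, of the
spaces of real functions on the powers of `ℕ`, with the product Borel structure. -/
abbrev CodeSpace (L : MetricLanguage.{u}) : Type u :=
  (ℕ → ℕ → ℝ) × ((R : L.Rel) → (Fin (L.arity R) → ℕ) → ℝ)

/-- `f` codes an `L`-structure: `f.1` is a pseudometric on `ℕ`, and the bounds and the uniform
continuity moduli of the language hold when `Q n` stands for the `n`-th domain. -/
structure IsCode (L : MetricLanguage.{u}) (E : Exhaustion) (f : CodeSpace L) : Prop where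
  dist_self : ∀ i, f.1 i i = 0
  dist_comm : ∀ i j, f.1 i j = f.1 j i
  dist_triangle : ∀ i j k, f.1 i k ≤ f.1 i j + f.1 j k
  dist_le : ∀ m n i j, i ∈ E.Q m → j ∈ E.Q n → f.1 i j ≤ L.distBound m n
  rel_le : ∀ R D a, (∀ i, a i ∈ E.Q (D i)) → |f.2 R a| ≤ L.bound R D
  rel_modulus : ∀ R D a b, (∀ i, a i ∈ E.Q (D i)) → (∀ i, b i ∈ E.Q (D i)) →
    ∀ ε, 0 < ε → (∀ i, f.1 (a i) (b i) < L.modulus R D ε) → |f.2 R a - f.2 R b| ≤ ε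

namespace IsCode

variable {L : MetricLanguage.{u}} {E : Exhaustion} {f : CodeSpace L}

/-- The natural numbers with the pseudometric `f.1`. -/
def Point (_ : IsCode L E f) : Type := ℕ

instance (h : IsCode L E f) : PseudoMetricSpace h.Point where
  dist i j := f.1 i j
  dist_self := h.dist_self
  dist_comm := h.dist_comm
  dist_triangle := h.dist_triangle

/-- The completion of `ℕ` with respect to `f.1`. -/
abbrev Compl (h : IsCode L E f) : Type := UniformSpace.Completion h.Point

/-- The canonical map from `ℕ` to its completion. -/
def toCompl (h : IsCode L E f) (i : ℕ) : h.Compl := ((show h.Point from i) : h.Compl)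

/-- The closure of `Q n` in the completion. -/
def closedDom (h : IsCode L E f) (n : ℕ) : Set h.Compl := closure (h.toCompl '' E.Q n)

/-- The support of the coded structure: the part of the completion of `ℕ` that is covered by the
closures of the sets `Q n`. -/
abbrev Carrier (h : IsCode L E f) : Type := {x : h.Compl // ∃ n, x ∈ h.closedDom n}

/-- The interpretation of the `n`-th domain of quantification. -/
def dom (h : IsCode L E f) (n : ℕ) : Set h.Carrier := {x | x.1 ∈ h.closedDom n}

theorem dist_toCompl (h : IsCode L E f) (i j : ℕ) :
    dist (h.toCompl i) (h.toCompl j) = f.1 i j :=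
  UniformSpace.Completion.dist_eq _ _

theorem closedDom_mono (h : IsCode L E f) : Monotone h.closedDom := fun _ _ hmn =>
  closure_mono (Set.image_mono (E.mono hmn))

theorem exists_approx (h : IsCode L E f) {n : ℕ} {x : h.Carrier} (hx : x ∈ h.dom n)
    {δ : ℝ} (hδ : 0 < δ) : ∃ a ∈ E.Q n, dist (h.toCompl a) x.1 < δ := by
  obtain ⟨_, ⟨a, ha, rfl⟩, hd⟩ := Metric.mem_closure_iff.1 hx δ hδ
  exact ⟨a, ha, by rwa [_root_.dist_comm]⟩

/-- `y` is the limit of `f.2 R` at `x` along each product of sets `Q n` whose closure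
contains `x`. -/
def IsRelLimit (h : IsCode L E f) (R : L.Rel) (x : Fin (L.arity R) → h.Carrier) (y : ℝ) : Prop :=
  ∀ D : Fin (L.arity R) → ℕ, (∀ i, x i ∈ h.dom (D i)) → ∀ ε : ℝ, 0 < ε → ∃ δ : ℝ, 0 < δ ∧
    ∀ a : Fin (L.arity R) → ℕ, (∀ i, a i ∈ E.Q (D i)) →
      (∀ i, dist (h.toCompl (a i)) (x i).1 < δ) → |f.2 R a - y| < ε

theorem exists_relLimit (h : IsCode L E f) (R : L.Rel) (x : Fin (L.arity R) → h.Carrier) :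
    ∃ y, h.IsRelLimit R x y := by
  choose D₀ hD₀ using fun i => (x i).2
  have happ : ∀ m : ℕ, ∀ i, ∃ a ∈ E.Q (D₀ i), dist (h.toCompl a) (x i).1 < 1 / ((m : ℝ) + 1) :=
    fun m i => h.exists_approx (n := D₀ i) (x := x i) (hD₀ i) (by positivity)
  choose a ha had using happ
  -- the key estimate
  have key : ∀ D : Fin (L.arity R) → ℕ, ∀ ε : ℝ, 0 < ε → ∃ δ : ℝ, 0 < δ ∧ ∃ m₀ : ℕ,
      ∀ b : Fin (L.arity R) → ℕ, (∀ i, b i ∈ E.Q (D i)) →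
      (∀ i, dist (h.toCompl (b i)) (x i).1 < δ) → ∀ m ≥ m₀, |f.2 R b - f.2 R (a m)| ≤ ε := by
    intro D ε hε
    let D' : Fin (L.arity R) → ℕ := fun i => max (D i) (D₀ i)
    have hpos := L.modulus_pos R D' ε hε
    obtain ⟨m₀, hm₀⟩ := exists_nat_one_div_lt (half_pos hpos)
    refine ⟨L.modulus R D' ε / 2, half_pos hpos, m₀, fun b hb hbd m hm => ?_⟩
    refine h.rel_modulus R D' b (a m) (fun i => E.mono (le_max_left _ _) (hb i))
      (fun i => E.mono (le_max_right _ _) (ha m i)) ε hε (fun i => ?_)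
    rw [← h.dist_toCompl]
    have h1 := _root_.dist_triangle_right (h.toCompl (b i)) (h.toCompl (a m i)) (x i).1
    have h2 := hbd i
    have h3 := had m i
    have h4 : 1 / ((m : ℝ) + 1) ≤ 1 / ((m₀ : ℝ) + 1) := by
      have : (m₀ : ℝ) ≤ m := by exact_mod_cast hm
      gcongr
    linarith
  have hcau : CauchySeq (fun m => f.2 R (a m)) := by
    refine Metric.cauchySeq_iff.2 fun ε hε => ?_
    obtain ⟨δ, hδ, m₀, hm₀⟩ := key D₀ (ε / 2) (half_pos hε)
    obtain ⟨m₁, hm₁⟩ := exists_nat_one_div_lt hδ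
    refine ⟨max m₀ m₁, fun p hp q hq => ?_⟩
    have h4 : 1 / ((p : ℝ) + 1) ≤ 1 / ((m₁ : ℝ) + 1) := by
      have : (m₁ : ℝ) ≤ p := by exact_mod_cast le_trans (le_max_right _ _) hp
      gcongr
    have := hm₀ (a p) (ha p) (fun i => by have := had p i; linarith) q
      (le_trans (le_max_left _ _) hq)
    rw [Real.dist_eq]
    linarith
  obtain ⟨y, hy⟩ := cauchySeq_tendsto_of_complete hcau
  refine ⟨y, fun D _ ε hε => ?_⟩
  obtain ⟨δ, hδ, m₀, hm₀⟩ := key D (ε / 2) (half_pos hε)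
  refine ⟨δ, hδ, fun b hb hbd => ?_⟩
  have : |f.2 R b - y| ≤ ε / 2 :=
    le_of_tendsto ((tendsto_const_nhds.sub hy).abs)
      (Filter.eventually_atTop.2 ⟨m₀, fun m hm => hm₀ b hb hbd m hm⟩)
  linarith

theorem IsRelLimit.unique {h : IsCode L E f} {R : L.Rel} {x : Fin (L.arity R) → h.Carrier}
    {y z : ℝ} (hy : h.IsRelLimit R x y) (hz : h.IsRelLimit R x z) : y = z := by
  choose D hD using fun i => (x i).2
  refine eq_of_abs_sub_le_all fun ε hε => ?_
  obtain ⟨δ, hδ, H⟩ := hy D hD (ε / 2) (half_pos hε)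
  obtain ⟨δ', hδ', H'⟩ := hz D hD (ε / 2) (half_pos hε)
  choose a ha had using fun i =>
    h.exists_approx (n := D i) (x := x i) (hD i) (lt_min hδ hδ')
  have h1 := H a ha fun i => (had i).trans_le (min_le_left _ _)
  have h2 := H' a ha fun i => (had i).trans_le (min_le_right _ _)
  have h3 := abs_sub_le y (f.2 R a) z
  rw [abs_sub_comm] at h1
  linarith

/-- The interpretation of a relation symbol: the extension of `f.2 R` by continuity. -/
noncomputable def rel (h : IsCode L E f) (R : L.Rel) (x : Fin (L.arity R) → h.Carrier) : ℝ :=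
  Classical.choose (h.exists_relLimit R x)

theorem rel_spec (h : IsCode L E f) (R : L.Rel) (x : Fin (L.arity R) → h.Carrier) :
    h.IsRelLimit R x (h.rel R x) :=
  Classical.choose_spec (h.exists_relLimit R x)

/-- The structure that is coded by `f`. -/
noncomputable def toStructure (h : IsCode L E f) : MetricStructure.{u, 0} L where
  carrier := h.Carrier
  dom := h.dom
  dom_nonempty n := by
    obtain ⟨i, hi⟩ := (E.infinite n).nonempty
    have : h.toCompl i ∈ h.closedDom n := subset_closure ⟨i, hi, rfl⟩
    exact ⟨⟨h.toCompl i, n, this⟩, this⟩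
  dom_complete n := by
    have hu : IsUniformInducing (Subtype.val : h.Carrier → h.Compl) :=
      isUniformEmbedding_subtype_val.isUniformInducing
    have : Subtype.val '' h.dom n = h.closedDom n := by
      ext x
      constructor
      · rintro ⟨y, hy, rfl⟩
        exact hy
      · intro hx
        exact ⟨⟨x, n, hx⟩, hx, rfl⟩
    refine (isComplete_image_iff hu).1 ?_
    rw [this]
    exact isClosed_closure.isComplete
  dom_cover x := x.2
  rel := h.rel
  dist_le m n x y hx hy := by
    refine le_of_forall_pos_le_add fun ε hε => ?_
    obtain ⟨a, ha, had⟩ := h.exists_approx hx (half_pos hε)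
    obtain ⟨b, hb, hbd⟩ := h.exists_approx hy (half_pos hε)
    have h1 := h.dist_le m n a b ha hb
    rw [← h.dist_toCompl] at h1
    have h2 := dist_triangle4 x.1 (h.toCompl a) (h.toCompl b) y.1
    rw [_root_.dist_comm x.1 (h.toCompl a)] at h2
    change dist x.1 y.1 ≤ _
    linarith
  rel_le R D x hx := by
    refine le_of_forall_pos_le_add fun ε hε => ?_
    obtain ⟨δ, hδ, H⟩ := h.rel_spec R x D hx ε hε
    choose a ha had using fun i => h.exists_approx (hx i) hδ
    have h1 := H a ha had
    have h2 := h.rel_le R D a ha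
    have h3 := abs_sub_abs_le_abs_sub (h.rel R x) (f.2 R a)
    rw [abs_sub_comm] at h1
    linarith
  rel_modulus R D x y hx hy ε hε hxy := by
    refine le_of_forall_pos_le_add fun η hη => ?_
    obtain ⟨δ, hδ, H⟩ := h.rel_spec R x D hx (η / 2) (half_pos hη)
    obtain ⟨δ', hδ', H'⟩ := h.rel_spec R y D hy (η / 2) (half_pos hη)
    have hs : ∀ i, 0 < (L.modulus R D ε - dist (x i) (y i)) / 2 := fun i => by
      have := hxy i
      linarith
    choose a ha had using fun i => h.exists_approx (hx i) (lt_min hδ (hs i))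
    choose b hb hbd using fun i => h.exists_approx (hy i) (lt_min hδ' (hs i))
    have h1 := H a ha fun i => (had i).trans_le (min_le_left _ _)
    have h2 := H' b hb fun i => (hbd i).trans_le (min_le_left _ _)
    have h3 := h.rel_modulus R D a b ha hb ε hε fun i => by
      rw [← h.dist_toCompl]
      have t1 := dist_triangle4 (h.toCompl (a i)) (x i).1 (y i).1 (h.toCompl (b i))
      have t2 := (had i).trans_le (min_le_right _ _)
      have t3 := (hbd i).trans_le (min_le_right _ _)
      rw [_root_.dist_comm] at t3
      have t4 : dist (x i) (y i) = dist (x i).1 (y i).1 := rfl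
      linarith
    have h4 := abs_sub_le (h.rel R x) (f.2 R a) (h.rel R y)
    have h5 := abs_sub_le (f.2 R a) (f.2 R b) (h.rel R y)
    rw [abs_sub_comm] at h1
    linarith

end IsCode

/-- The set of codes for `L`-structures. -/
def codes (L : MetricLanguage.{u}) (E : Exhaustion) : Set (CodeSpace L) :=
  {f | IsCode L E f}

/-- The set of codes for proper `L`-structures. -/
def properCodes (L : MetricLanguage.{u}) (E : Exhaustion) : Set (CodeSpace L) :=
  {f | ∃ h : IsCode L E f, h.toStructure.IsProper}

/-- The proper `L`-structure with a given code. -/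
noncomputable def structureOfCode {L : MetricLanguage.{u}} {E : Exhaustion}
    (f : properCodes L E) : MetricStructure.{u, 0} L :=
  IsCode.toStructure f.2.choose

/-- The relation of isomorphism of proper `L`-structures, on their codes. -/
def properIsomorphism (L : MetricLanguage.{u}) (E : Exhaustion) (f g : properCodes L E) : Prop :=
  (structureOfCode f).Isomorphic (structureOfCode g)

-- Write M ≤ N if no restricted prenex universal sentence has a larger value in M than in N. The
-- core is that, for proper structures with increasing domains, M ≤ N makes M embed into N. Given a
-- tuple of M and finitely many atoms, a connective measuring minus the deviation from the atoms'
-- values at that tuple has value 0 there. Its supremum over the domains is then at least 0 in M,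
-- and nearly so in N, where compactness makes it attained: some tuple of N realizes the atoms
-- approximately (`exists_tuple_of_sentenceValue_le`). With one variable for each element of M,
-- ranging over a compact domain of N, Tychonoff's theorem turns the finite approximations into an
-- exact realization of the whole atomic diagram, which is an embedding
-- (`exists_embedding_of_sentenceValue_le`).
--
-- Equal values thus give embeddings both ways. Their composite maps each compact domain
-- isometrically into itself, hence onto itself, so the embeddings are isomorphisms
-- (`isomorphic_of_embeddings`).
--
-- Borelness rests on the named points being dense in each domain: the values of a formula at named
-- points are Borel by induction, since quantifiers become countable suprema and infima
-- (`measurable_value_point`). Properness is total boundedness of the sets `Q n`, a countable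
-- condition on the code. Smoothness follows because `ℕ → ℝ` embeds in `ℝ` as a Borel set.

universe w w'

open Set Topology

/-! ## Continuity of formulas on products of domains -/

namespace MetricFormula

variable {L : MetricLanguage.{u}}

/-- The tuples whose `i`-th entry lies in the domain `Γ i`. -/
def domPi (M : MetricStructure.{u, v} L) {n : ℕ} (Γ : Fin n → ℕ) : Set (Fin n → M.carrier) :=
  {x | ∀ i, x i ∈ M.dom (Γ i)}

theorem snoc_mem_domPi {M : MetricStructure.{u, v} L} {n : ℕ} {Γ : Fin n → ℕ} {D : ℕ}
    {x : Fin n → M.carrier} {a : M.carrier} (hx : x ∈ domPi M Γ) (ha : a ∈ M.dom D) :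
    Fin.snoc (α := fun _ => M.carrier) x a ∈ domPi M (Fin.snoc (α := fun _ => ℕ) Γ D) := by
  intro i
  induction i using Fin.lastCases with
  | last => simpa using ha
  | cast i => simpa using hx i

theorem continuousOn_rel (M : MetricStructure.{u, v} L) (R : L.Rel) (D : Fin (L.arity R) → ℕ) :
    ContinuousOn (M.rel R) {x | ∀ i, x i ∈ M.dom (D i)} := by
  rw [Metric.continuousOn_iff]
  intro x hx ε hε
  refine ⟨L.modulus R D (ε / 2), L.modulus_pos _ _ _ (half_pos hε), fun y hy hxy => ?_⟩
  have := M.rel_modulus R D y x hy hx (ε / 2) (half_pos hε)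
    fun i => (dist_le_pi_dist y x i).trans_lt hxy
  rw [Real.dist_eq]
  linarith

theorem continuous_value_snoc {M : MetricStructure.{u, v} L} {n D : ℕ} {Γ : Fin n → ℕ}
    {φ : MetricFormula L (n + 1)}
    (hφ : ContinuousOn (φ.value M) (domPi M (Fin.snoc (α := fun _ => ℕ) Γ D))) :
    Continuous fun p : domPi M Γ × M.dom D =>
      φ.value M (Fin.snoc (α := fun _ => M.carrier) p.1.1 p.2.1) := by
  refine hφ.comp_continuous ?_ fun p => snoc_mem_domPi p.1.2 p.2.2
  refine continuous_pi fun i => ?_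
  induction i using Fin.lastCases with
  | last =>
    simp only [Fin.snoc_last]
    exact continuous_subtype_val.comp continuous_snd
  | cast i =>
    simp only [Fin.snoc_castSucc]
    exact (continuous_apply i).comp (continuous_subtype_val.comp continuous_fst)

/-- By induction. A quantifier ranges over a compact domain, and the supremum or infimum of a
jointly continuous function over a compact parameter space is continuous in the remaining variables.
Well-formedness plays no role, since `projIcc` is continuous. -/
theorem continuousOn_value {M : MetricStructure.{u, v} L} (hM : M.IsProper) :
    ∀ {n : ℕ} (φ : MetricFormula L n) (Γ : Fin n → ℕ), ContinuousOn (φ.value M) (domPi M Γ)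
  | _, dist i j, Γ => by
      simp only [value]
      fun_prop
  | _, rel R w, Γ => by
      simp only [value]
      refine (continuousOn_rel M R fun i => Γ (w i)).comp (by fun_prop) fun x hx i => hx (w i)
  | _, conn b k f φ, Γ => by
      simp only [value]
      refine (continuous_subtype_val.comp f.continuous).comp_continuousOn ?_
      exact continuousOn_pi.2 fun i =>
        continuous_projIcc.comp_continuousOn (continuousOn_value hM (φ i) Γ)
  | _, sup D φ, Γ => by
      have : CompactSpace (M.dom D) := isCompact_iff_compactSpace.1 (hM D)
      rw [continuousOn_iff_continuous_domRestrict]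
      have h := isCompact_univ.continuous_sSup
        (f := fun (x : domPi M Γ) (a : M.dom D) =>
          φ.value M (Fin.snoc (α := fun _ => M.carrier) x.1 a.1))
        (continuous_value_snoc (continuousOn_value hM φ _))
      simp only [image_univ] at h
      exact h
  | _, inf D φ, Γ => by
      have : CompactSpace (M.dom D) := isCompact_iff_compactSpace.1 (hM D)
      rw [continuousOn_iff_continuous_domRestrict]
      have h := isCompact_univ.continuous_sInf
        (f := fun (x : domPi M Γ) (a : M.dom D) =>
          φ.value M (Fin.snoc (α := fun _ => M.carrier) x.1 a.1))
        (continuous_value_snoc (continuousOn_value hM φ _))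
      simp only [image_univ] at h
      exact h

/-! ## Invariance under isomorphism -/

theorem value_of_iso {M N : MetricStructure.{u, v} L} (e : M.carrier ≃ᵢ N.carrier)
    (hdom : ∀ n, e '' M.dom n = N.dom n)
    (hrel : ∀ R x, N.rel R (fun i => e (x i)) = M.rel R x) :
    ∀ {n : ℕ} (φ : MetricFormula L n) (x : Fin n → M.carrier),
      φ.value N (fun i => e (x i)) = φ.value M x
  | _, dist i j, x => e.dist_eq _ _
  | _, rel R w, x => hrel R fun i => x (w i)
  | _, conn b k f φ, x => by
      simp only [value, fun i => value_of_iso e hdom hrel (φ i) x]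
  | _, sup D φ, x => by
      simp only [value]
      -- The isomorphism reindexes the supremum, since it carries `M.dom D` onto `N.dom D`.
      refine (Equiv.iSup_congr ((e.toEquiv.image (M.dom D)).trans (Equiv.setCongr (hdom D)))
        fun a => ?_).symm
      rw [← value_of_iso e hdom hrel φ]
      congr 1
      exact (Fin.comp_snoc e x a.1).symm
  | _, inf D φ, x => by
      simp only [value]
      refine (Equiv.iInf_congr ((e.toEquiv.image (M.dom D)).trans (Equiv.setCongr (hdom D)))
        fun a => ?_).symm
      rw [← value_of_iso e hdom hrel φ]
      congr 1
      exact (Fin.comp_snoc e x a.1).symm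

/-! ## Syntactic facts -/

theorem IsQuantifierFree.isPrenexUniversal {n : ℕ} {φ : MetricFormula L n}
    (h : φ.IsQuantifierFree) : φ.IsPrenexUniversal := by
  cases φ <;> simp_all [IsPrenexUniversal, IsQuantifierFree]

theorem IsQuantifierFree.isUniversal : ∀ {n : ℕ} {φ : MetricFormula L n},
    φ.IsQuantifierFree → φ.IsUniversal
  | _, dist _ _, _ => trivial
  | _, rel _ _, _ => trivial
  | _, conn _ _ _ _, h => fun i => (h i).isUniversal

theorem IsPrenexUniversal.isUniversal : ∀ {n : ℕ} {φ : MetricFormula L n},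
    φ.IsPrenexUniversal → φ.IsUniversal
  | _, dist _ _, _ => trivial
  | _, rel _ _, _ => trivial
  | _, conn _ _ _ _, h => IsQuantifierFree.isUniversal (by simpa [IsPrenexUniversal] using h)
  | _, sup _ φ, h => IsPrenexUniversal.isUniversal (φ := φ) (by simpa [IsPrenexUniversal] using h)
  | _, inf _ _, h => by simp [IsPrenexUniversal, IsQuantifierFree] at h

/-- The restricted formulas in which connectives and quantifiers are nested less than `d` deep. -/
def restrictedDepth (L : MetricLanguage.{u}) (F : (b k : ℕ) → Set (Connective b k)) :
    ℕ → (n : ℕ) → Set (MetricFormula L n)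
  | 0, _ => ∅
  | d + 1, n =>
      range (fun p : Fin n × Fin n => dist p.1 p.2) ∪
      range (fun p : (R : L.Rel) × (Fin (L.arity R) → Fin n) => rel p.1 p.2) ∪
      (⋃ b, ⋃ k, image2 (conn b k) (F b k) (univ.pi fun _ => restrictedDepth L F d n)) ∪
      (⋃ D, sup D '' restrictedDepth L F d (n + 1)) ∪
      (⋃ D, inf D '' restrictedDepth L F d (n + 1))

variable {F : (b k : ℕ) → Set (Connective b k)}

/-- Each level arises from the previous one by countably many constructors, and a connective takes
only a finite tuple of arguments. -/
theorem countable_restrictedDepth [Countable L.Rel] (hF : ∀ b k, (F b k).Countable) (d : ℕ) :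
    ∀ n, (restrictedDepth L F d n).Countable := by
  induction d with
  | zero => exact fun _ => countable_empty
  | succ d ih =>
    intro n
    refine ((((countable_range _).union (countable_range _)).union ?_).union ?_).union ?_
    · exact countable_iUnion fun b => countable_iUnion fun k =>
        (hF b k).image2 (countable_univ_pi fun _ => ih n) _
    · exact countable_iUnion fun D => (ih (n + 1)).image _
    · exact countable_iUnion fun D => (ih (n + 1)).image _

theorem restrictedDepth_succ (d : ℕ) :
    ∀ n, restrictedDepth L F d n ⊆ restrictedDepth L F (d + 1) n := by
  induction d with
  | zero => exact fun _ => empty_subset _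
  | succ d ih =>
    intro n
    refine union_subset_union (union_subset_union (union_subset_union Subset.rfl ?_) ?_) ?_
    · exact iUnion_mono fun b => iUnion_mono fun k =>
        image2_subset Subset.rfl (pi_mono fun _ _ => ih n)
    · exact iUnion_mono fun D => image_mono (ih _)
    · exact iUnion_mono fun D => image_mono (ih _)

theorem IsRestricted.exists_depth : ∀ {n : ℕ} {φ : MetricFormula L n}, φ.IsRestricted F →
    ∃ d, φ ∈ restrictedDepth L F d n
  | _, dist i j, _ => ⟨1, .inl (.inl (.inl (.inl ⟨(i, j), rfl⟩)))⟩
  | _, rel R w, _ => ⟨1, .inl (.inl (.inl (.inr ⟨⟨R, w⟩, rfl⟩)))⟩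
  | n, conn b k f φ, h => by
      choose d hd using fun i => (h.2 i).exists_depth
      have hmono : Monotone fun d => restrictedDepth L F d n :=
        monotone_nat_of_le_succ fun d => restrictedDepth_succ d n
      exact ⟨Finset.univ.sup d + 1, .inl (.inl (.inr (mem_iUnion₂.2 ⟨b, k, f, h.1, φ,
        fun i _ => hmono (Finset.le_sup (f := d) (Finset.mem_univ i)) (hd i), rfl⟩)))⟩
  | _, sup D φ, h => by
      obtain ⟨d, hd⟩ := IsRestricted.exists_depth (φ := φ) h
      exact ⟨d + 1, .inl (.inr (mem_iUnion.2 ⟨D, φ, hd, rfl⟩))⟩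
  | _, inf D φ, h => by
      obtain ⟨d, hd⟩ := IsRestricted.exists_depth (φ := φ) h
      exact ⟨d + 1, .inr (mem_iUnion.2 ⟨D, φ, hd, rfl⟩)⟩

theorem countable_isRestricted [Countable L.Rel] (hF : ∀ b k, (F b k).Countable) (n : ℕ) :
    {φ : MetricFormula L n | φ.IsRestricted F}.Countable :=
  (countable_iUnion fun d => countable_restrictedDepth hF d n).mono fun _ h =>
    mem_iUnion.2 (IsRestricted.exists_depth h)

end MetricFormula

theorem restrictedPrenexUniversalSentences_subset (L : MetricLanguage.{u})
    (F : (b k : ℕ) → Set (Connective b k)) :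
    restrictedPrenexUniversalSentences L F ⊆ restrictedUniversalSentences L F :=
  fun _ h => ⟨h.1, h.2.1, h.2.2.isUniversal⟩

theorem countable_restrictedUniversalSentences {L : MetricLanguage.{u}} [Countable L.Rel]
    {F : (b k : ℕ) → Set (Connective b k)} (hF : ∀ b k, (F b k).Countable) :
    (restrictedUniversalSentences L F).Countable :=
  (MetricFormula.countable_isRestricted hF 0).mono fun _ h => h.2.1

theorem UniformlyDense.nonempty {F : (b k : ℕ) → Set (Connective b k)} (hF : UniformlyDense F)
    (b k : ℕ) : (F b k).Nonempty := by
  obtain ⟨f, hf, -⟩ := hF b k (ContinuousMap.const _ ⟨0, by simp⟩) 1 one_pos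
  exact ⟨f, hf⟩

theorem nonempty_restrictedPrenexUniversalSentences (L : MetricLanguage.{u})
    {F : (b k : ℕ) → Set (Connective b k)} (hF : UniformlyDense F) :
    (restrictedPrenexUniversalSentences L F).Nonempty := by
  -- A connective without arguments is a sentence on its own, so no symbol of the language is
  -- needed.
  obtain ⟨f, hf⟩ := hF.nonempty 0 0
  refine ⟨.conn 0 0 f Fin.elim0, fun i => i.elim0, ⟨hf, fun i => i.elim0⟩, ?_⟩
  exact MetricFormula.IsQuantifierFree.isPrenexUniversal fun i => i.elim0

/-! ## Codes form Borel sets -/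

section Codes

variable {L : MetricLanguage.{u}} {E : Exhaustion}

/-- Every single condition involves finitely many coordinates and is closed; for the moduli, an open
premise implies a closed conclusion. Closedness, rather than Borelness, absorbs the uncountable
intersection over real `ε`. -/
theorem isClosed_codes (L : MetricLanguage.{u}) (E : Exhaustion) : IsClosed (codes L E) := by
  have heq : codes L E =
      {f | ∀ i, f.1 i i = 0} ∩ {f | ∀ i j, f.1 i j = f.1 j i} ∩
      {f | ∀ i j k, f.1 i k ≤ f.1 i j + f.1 j k} ∩
      {f | ∀ m n i j, i ∈ E.Q m → j ∈ E.Q n → f.1 i j ≤ L.distBound m n} ∩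
      {f | ∀ R D a, (∀ i, a i ∈ E.Q (D i)) → |f.2 R a| ≤ L.bound R D} ∩
      {f | ∀ R D a b, (∀ i, a i ∈ E.Q (D i)) → (∀ i, b i ∈ E.Q (D i)) →
        ∀ ε, 0 < ε → (∀ i, f.1 (a i) (b i) < L.modulus R D ε) → |f.2 R a - f.2 R b| ≤ ε} := by
    ext f
    exact ⟨fun h => ⟨⟨⟨⟨⟨h.1, h.2⟩, h.3⟩, h.4⟩, h.5⟩, h.6⟩,
      fun h => ⟨h.1.1.1.1.1, h.1.1.1.1.2, h.1.1.1.2, h.1.1.2, h.1.2, h.2⟩⟩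
  rw [heq]
  refine ((((IsClosed.inter ?_ ?_).inter ?_).inter ?_).inter ?_).inter ?_ <;>
    simp only [ofPred_forall]
  · exact isClosed_iInter fun i => isClosed_eq (by fun_prop) (by fun_prop)
  · exact isClosed_iInter fun i => isClosed_iInter fun j => isClosed_eq (by fun_prop) (by fun_prop)
  · exact isClosed_iInter fun i => isClosed_iInter fun j => isClosed_iInter fun k =>
      isClosed_le (by fun_prop) (by fun_prop)
  · exact isClosed_iInter fun m => isClosed_iInter fun n => isClosed_iInter fun i =>
      isClosed_iInter fun j => isClosed_iInter fun _ => isClosed_iInter fun _ =>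
      isClosed_le (by fun_prop) (by fun_prop)
  · exact isClosed_iInter fun R => isClosed_iInter fun D => isClosed_iInter fun a =>
      isClosed_iInter fun _ => isClosed_le (by fun_prop) (by fun_prop)
  · refine isClosed_iInter fun R => isClosed_iInter fun D => isClosed_iInter fun a =>
      isClosed_iInter fun b => isClosed_iInter fun _ => isClosed_iInter fun _ =>
      isClosed_iInter fun ε => isClosed_iInter fun _ => ?_
    refine isClosed_imp ?_ (isClosed_le (by fun_prop) (by fun_prop))
    simp only [ofPred_forall]
    exact isOpen_iInter_of_finite fun i => isOpen_lt (by fun_prop) (by fun_prop)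

theorem measurableSet_codes (L : MetricLanguage.{u}) [Countable L.Rel] (E : Exhaustion) :
    MeasurableSet (codes L E) :=
  (isClosed_codes L E).measurableSet

/-- A closed subset of the completion is complete, so compactness is total boundedness, which passes
between a set and its closure. -/
theorem IsCode.isCompact_dom_iff (h : IsCode L E f) (n : ℕ) :
    IsCompact (h.dom n) ↔ TotallyBounded (h.toCompl '' E.Q n) := by
  have himg : Subtype.val '' h.dom n = h.closedDom n := by
    ext x
    exact ⟨by rintro ⟨y, hy, rfl⟩; exact hy, fun hx => ⟨⟨x, n, hx⟩, hx, rfl⟩⟩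
  rw [Subtype.isCompact_iff, himg, isCompact_iff_totallyBounded_isComplete]
  refine ⟨fun H => H.1.subset subset_closure, fun H => ⟨H.closure, isClosed_closure.isComplete⟩⟩

theorem IsCode.totallyBounded_iff (h : IsCode L E f) (n : ℕ) :
    TotallyBounded (h.toCompl '' E.Q n) ↔
      ∀ m : ℕ, ∃ t : Finset ℕ, ∀ i ∈ E.Q n, ∃ j ∈ t, f.1 i j < 1 / ((m : ℝ) + 1) := by
  constructor
  · intro H m
    obtain ⟨t, hts, htf, ht⟩ :=
      -- The centres are taken inside the image of `E.Q n`, so that they have names in `ℕ`.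
      Metric.finite_approx_of_totallyBounded H (1 / ((m : ℝ) + 1)) (by positivity)
    obtain ⟨s, -, hsf, hs⟩ := exists_subset_image_finite_and.1 ⟨t, hts, htf, rfl⟩
    refine ⟨hsf.toFinset, fun i hi => ?_⟩
    obtain ⟨y, hy, hiy⟩ := mem_iUnion₂.1 (ht ⟨i, hi, rfl⟩)
    rw [hs] at hy
    obtain ⟨j, hj, rfl⟩ := hy
    exact ⟨j, by simpa using hj, by rw [← h.dist_toCompl]; exact hiy⟩
  · intro H
    refine Metric.totallyBounded_iff.2 fun ε hε => ?_
    obtain ⟨m, hm⟩ := exists_nat_one_div_lt hε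
    obtain ⟨t, ht⟩ := H m
    refine ⟨h.toCompl '' t, t.finite_toSet.image _, ?_⟩
    rintro _ ⟨i, hi, rfl⟩
    obtain ⟨j, hj, hij⟩ := ht i hi
    refine mem_iUnion₂.2 ⟨_, ⟨j, hj, rfl⟩, ?_⟩
    rw [Metric.mem_ball, h.dist_toCompl]
    exact hij.trans hm

theorem measurableSet_properCodes (L : MetricLanguage.{u}) [Countable L.Rel] (E : Exhaustion) :
    MeasurableSet (properCodes L E) := by
  have heq : properCodes L E = codes L E ∩
      ⋂ n, ⋂ m : ℕ, ⋃ t : Finset ℕ, ⋂ i ∈ E.Q n, ⋃ j ∈ t,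
        {f | f.1 i j < 1 / ((m : ℝ) + 1)} := by
    ext f
    simp only [mem_inter_iff, mem_iInter, mem_iUnion, mem_ofPred_eq, exists_prop]
    exact ⟨fun ⟨h, hp⟩ => ⟨h, fun n =>
        (h.totallyBounded_iff n).1 ((h.isCompact_dom_iff n).1 (hp n))⟩,
      fun ⟨h, hp⟩ => ⟨h, fun n =>
        (IsCode.isCompact_dom_iff h n).2 ((IsCode.totallyBounded_iff h n).2 (hp n))⟩⟩
  rw [heq]
  refine (measurableSet_codes L E).inter <| .iInter fun n => .iInter fun m => .iUnion fun t =>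
    .biInter (to_countable _) fun i _ => .biUnion (to_countable _) fun j _ => ?_
  exact measurableSet_lt (by fun_prop) (by fun_prop)

end Codes

/-! ## Values of formulas are Borel functions of the code -/

namespace IsCode

variable {L : MetricLanguage.{u}} {E : Exhaustion} {f : CodeSpace L}

/-- The element of the coded structure that is named by a natural number. -/
def point (h : IsCode L E f) (i : ℕ) : h.toStructure.carrier :=
  ⟨h.toCompl i, by
    obtain ⟨n, hn⟩ := mem_iUnion.1 (E.iUnion_eq ▸ mem_univ i : i ∈ ⋃ n, E.Q n)
    exact ⟨n, subset_closure ⟨i, hn, rfl⟩⟩⟩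

theorem point_mem_dom (h : IsCode L E f) {i n : ℕ} (hi : i ∈ E.Q n) :
    h.point i ∈ h.toStructure.dom n :=
  subset_closure (⟨i, hi, rfl⟩ : h.toCompl i ∈ h.toCompl '' E.Q n)

theorem rel_point (h : IsCode L E f) (R : L.Rel) (a : Fin (L.arity R) → ℕ) :
    h.toStructure.rel R (fun i => h.point (a i)) = f.2 R a := by
  choose D hD using fun i => mem_iUnion.1 (E.iUnion_eq ▸ mem_univ (a i) : a i ∈ ⋃ n, E.Q n)
  refine (eq_of_abs_sub_le_all fun ε hε => ?_).symm
  obtain ⟨δ, hδ, H⟩ := h.rel_spec R (fun i => h.point (a i)) D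
    (fun i => h.point_mem_dom (hD i)) ε hε
  exact (H a hD fun i => by simpa [point] using hδ).le

theorem monotone_dom (h : IsCode L E f) : Monotone h.toStructure.dom :=
  fun _ _ hmn _ hx => h.closedDom_mono hmn hx

theorem dense_range_point (h : IsCode L E f) (n : ℕ) :
    Dense (range fun i : E.Q n =>
      (⟨h.point i, h.point_mem_dom i.2⟩ : h.toStructure.dom n)) := by
  refine Metric.dense_iff.2 fun x r hr => ?_
  obtain ⟨a, ha, hd⟩ := h.exists_approx x.2 hr
  exact ⟨_, hd, ⟨⟨a, ha⟩, rfl⟩⟩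

end IsCode

theorem isCode_of_mem_properCodes {L : MetricLanguage.{u}} {E : Exhaustion}
    (f : properCodes L E) : IsCode L E f.1 :=
  f.2.choose

theorem isProper_structureOfCode {L : MetricLanguage.{u}} {E : Exhaustion}
    (f : properCodes L E) : (structureOfCode f).IsProper :=
  f.2.choose_spec

namespace MetricFormula

variable {L : MetricLanguage.{u}} {E : Exhaustion}

theorem continuous_value_snoc_apply {M : MetricStructure.{u, v} L} (hM : M.IsProper) {n D : ℕ}
    (φ : MetricFormula L (n + 1)) (x : Fin n → M.carrier) :
    Continuous fun a : M.dom D => φ.value M (Fin.snoc (α := fun _ => M.carrier) x a.1) := by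
  choose Γ hΓ using fun i => M.dom_cover (x i)
  exact (continuous_value_snoc (Γ := Γ) (continuousOn_value hM φ _)).comp
    (Continuous.prodMk_right (⟨x, hΓ⟩ : domPi M Γ))

/-- The supremum of a continuous function is already determined on the dense set of named points.
The new index set `E.Q D` is countable and does not depend on the code. -/
theorem value_sup_point {f : CodeSpace L} (h : IsCode L E f) (hp : h.toStructure.IsProper)
    {n D : ℕ} (φ : MetricFormula L (n + 1)) (a : Fin n → ℕ) :
    (sup D φ).value h.toStructure (fun i => h.point (a i)) =
      ⨆ i : E.Q D, φ.value h.toStructure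
        (fun j => h.point (Fin.snoc (α := fun _ => ℕ) a i.1 j)) := by
  simp only [value]
  refine ((h.dense_range_point D).ciSup' (continuous_value_snoc_apply hp φ _)).symm.trans ?_
  refine (iSup_range' (fun x : h.toStructure.dom D => φ.value h.toStructure
    (Fin.snoc (α := fun _ => h.toStructure.carrier) (fun i => h.point (a i)) x.1)) _).trans ?_
  exact iSup_congr fun i => congrArg _ (Fin.comp_snoc h.point a i.1).symm

theorem value_inf_point {f : CodeSpace L} (h : IsCode L E f) (hp : h.toStructure.IsProper)
    {n D : ℕ} (φ : MetricFormula L (n + 1)) (a : Fin n → ℕ) :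
    (inf D φ).value h.toStructure (fun i => h.point (a i)) =
      ⨅ i : E.Q D, φ.value h.toStructure
        (fun j => h.point (Fin.snoc (α := fun _ => ℕ) a i.1 j)) := by
  simp only [value]
  refine ((h.dense_range_point D).ciInf' (continuous_value_snoc_apply hp φ _)).symm.trans ?_
  refine (iInf_range' (fun x : h.toStructure.dom D => φ.value h.toStructure
    (Fin.snoc (α := fun _ => h.toStructure.carrier) (fun i => h.point (a i)) x.1)) _).trans ?_
  exact iInf_congr fun i => congrArg _ (Fin.comp_snoc h.point a i.1).symm

/-- The structure varies with the code, so the induction runs over tuples of names. Atoms are then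
coordinates of the code. -/
theorem measurable_value_point : ∀ {n : ℕ} (φ : MetricFormula L n) (a : Fin n → ℕ),
    Measurable fun f : properCodes L E =>
      φ.value (structureOfCode f) (fun i => (isCode_of_mem_properCodes f).point (a i))
  | _, dist i j, a => by
      have : Measurable fun f : properCodes L E => f.1.1 (a i) (a j) := by fun_prop
      convert this using 2 with f
      exact (isCode_of_mem_properCodes f).dist_toCompl _ _
  | _, rel R w, a => by
      have : Measurable fun f : properCodes L E => f.1.2 R (fun i => a (w i)) := by fun_prop
      convert this using 2 with f
      exact (isCode_of_mem_properCodes f).rel_point R _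
  | _, conn b k g φ, a => by
      simp only [value]
      refine (measurable_subtype_coe.comp g.continuous.measurable).comp ?_
      exact measurable_pi_lambda _ fun i =>
        continuous_projIcc.measurable.comp (measurable_value_point (φ i) a)
  | _, sup D φ, a => by
      have : Measurable fun f : properCodes L E => ⨆ i : E.Q D, φ.value (structureOfCode f)
          (fun j => (isCode_of_mem_properCodes f).point (Fin.snoc (α := fun _ => ℕ) a i.1 j)) :=
        .iSup fun i => measurable_value_point φ _
      convert this using 2 with f
      exact value_sup_point _ (isProper_structureOfCode f) φ a
  | _, inf D φ, a => by
      have : Measurable fun f : properCodes L E => ⨅ i : E.Q D, φ.value (structureOfCode f)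
          (fun j => (isCode_of_mem_properCodes f).point (Fin.snoc (α := fun _ => ℕ) a i.1 j)) :=
        .iInf fun i => measurable_value_point φ _
      convert this using 2 with f
      exact value_inf_point _ (isProper_structureOfCode f) φ a

theorem measurable_sentenceValue (φ : MetricFormula L 0) :
    Measurable fun f : properCodes L E => (structureOfCode f).sentenceValue φ := by
  convert measurable_value_point (E := E) φ Fin.elim0 using 3 with f
  exact congrArg _ (funext fun i => i.elim0)

end MetricFormula

/-! ## Embeddings of proper structures -/

/-- A point of `K` outside the compact set `f '' K` has positive distance `δ` from it. Its orbit
under `f` is then `δ`-separated and has no convergent subsequence. -/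
theorem Isometry.surjOn_of_isCompact {X : Type v} [MetricSpace X] {f : X → X} (hf : Isometry f)
    {K : Set X} (hK : IsCompact K) (hfK : MapsTo f K K) : SurjOn f K K := by
  intro y hy
  by_contra hy'
  obtain ⟨δ, hδ, hball⟩ :=
    Metric.isOpen_iff.1 (hK.image hf.continuous).isClosed.isOpen_compl y hy'
  have hmem : ∀ n, f^[n] y ∈ K := fun n => hfK.iterate n hy
  have hiter : ∀ n, Isometry f^[n] := fun n => by
    induction n with
    | zero => exact isometry_id
    | succ n ih => exact ih.comp hf
  have hsep : ∀ m n, m < n → δ ≤ dist (f^[n] y) (f^[m] y) := by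
    intro m n hmn
    obtain ⟨k, rfl⟩ := Nat.exists_eq_add_of_lt hmn
    -- Cancelling the isometry `f^[m]` leaves the distance from `y` to a point of `f '' K`.
    rw [show m + k + 1 = m + (k + 1) by ring, Function.iterate_add_apply,
      (hiter m).dist_eq, Function.iterate_succ_apply']
    by_contra! h
    exact hball h ⟨_, hmem k, rfl⟩
  obtain ⟨z, -, φ, hφ, hlim⟩ := hK.tendsto_subseq hmem
  obtain ⟨n₀, hn₀⟩ := Metric.cauchySeq_iff.1 hlim.cauchySeq δ hδ
  have h1 := hn₀ (n₀ + 1) (by omega) n₀ le_rfl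
  exact absurd h1 (not_lt.2 (hsep _ _ (hφ (Nat.lt_succ_self n₀))))

namespace MetricStructure

variable {L : MetricLanguage.{u}}

/-- Embeddings: isometric maps that respect the domains and preserve the relations. -/
structure IsEmbedding (M : MetricStructure.{u, v} L) (N : MetricStructure.{u, w} L)
    (e : M.carrier → N.carrier) : Prop where
  isometry : Isometry e
  mapsTo : ∀ n, MapsTo e (M.dom n) (N.dom n)
  rel : ∀ R x, N.rel R (fun i => e (x i)) = M.rel R x

theorem isomorphic_of_embeddings {M N : MetricStructure.{u, v} L} (hM : M.IsProper)
    {e : M.carrier → N.carrier} {e' : N.carrier → M.carrier} (he : M.IsEmbedding N e)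
    (he' : N.IsEmbedding M e') : M.Isomorphic N := by
  have hsurj : ∀ n, ∀ y ∈ N.dom n, ∃ x ∈ M.dom n, e x = y := by
    intro n y hy
    -- The composite `e' ∘ e` is onto `M.dom n`, so it hits `e' y`; injectivity of `e'` then gives
    -- `e x = y`.
    obtain ⟨x, hx, hxy⟩ := (he'.isometry.comp he.isometry).surjOn_of_isCompact (hM n)
      ((he'.mapsTo n).comp (he.mapsTo n)) (he'.mapsTo n hy)
    exact ⟨x, hx, he'.isometry.injective hxy⟩
  have hbij : Function.Bijective e := by
    refine ⟨he.isometry.injective, fun y => ?_⟩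
    obtain ⟨n, hn⟩ := N.dom_cover y
    obtain ⟨x, -, hx⟩ := hsurj n y hn
    exact ⟨x, hx⟩
  refine ⟨⟨Equiv.ofBijective e hbij, he.isometry⟩, fun n => ?_, he.rel⟩
  exact Subset.antisymm (mapsTo_iff_image_subset.1 (he.mapsTo n)) fun y hy => hsurj n y hy

theorem Isomorphic.refl (M : MetricStructure.{u, v} L) : M.Isomorphic M :=
  ⟨IsometryEquiv.refl _, fun _ => image_id _, fun _ _ => rfl⟩

theorem Isomorphic.symm {M N : MetricStructure.{u, v} L} :
    M.Isomorphic N → N.Isomorphic M := by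
  rintro ⟨e, hdom, hrel⟩
  refine ⟨e.symm, fun n => ?_, fun R x => ?_⟩
  · rw [← hdom n, ← image_comp]
    simp
  · rw [← hrel]
    simp

theorem Isomorphic.trans {M N P : MetricStructure.{u, v} L} :
    M.Isomorphic N → N.Isomorphic P → M.Isomorphic P := by
  rintro ⟨e, hdom, hrel⟩ ⟨e', hdom', hrel'⟩
  refine ⟨e.trans e', fun n => ?_, fun R x => ?_⟩
  · rw [← hdom' n, ← hdom n, ← image_comp]
    rfl
  · rw [← hrel R x, ← hrel' R fun i => e (x i)]
    rfl

theorem Isomorphic.sentenceValue_eq {M N : MetricStructure.{u, v} L} (h : M.Isomorphic N)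
    (φ : MetricFormula L 0) : M.sentenceValue φ = N.sentenceValue φ := by
  obtain ⟨e, hdom, hrel⟩ := h
  rw [sentenceValue, ← MetricFormula.value_of_iso e hdom hrel]
  exact congrArg _ (funext fun i => i.elim0)

end MetricStructure

/-! ### Blocks of suprema over all free variables -/

namespace MetricFormula

variable {L : MetricLanguage.{u}}

/-- The sentence obtained from `ψ` by quantifying `sup x i ∈ Γ i` over all free variables. -/
def supBlock : {n : ℕ} → (Fin n → ℕ) → MetricFormula L n → MetricFormula L 0
  | 0, _, ψ => ψ
  | n + 1, Γ, ψ => supBlock (Fin.init (α := fun _ => ℕ) Γ) (sup (Γ (Fin.last n)) ψ)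

theorem wellFormed_supBlock : ∀ {n : ℕ} {Γ : Fin n → ℕ} {ψ : MetricFormula L n},
    ψ.WellFormed Γ → (supBlock Γ ψ).WellFormed Fin.elim0
  | 0, Γ, ψ, h => by rwa [supBlock, ← Subsingleton.elim Γ Fin.elim0]
  | n + 1, Γ, ψ, h => by
      refine wellFormed_supBlock (ψ := sup (Γ (Fin.last n)) ψ) ?_
      change ψ.WellFormed _
      rwa [Fin.snoc_init_self]

theorem isPrenexUniversal_supBlock : ∀ {n : ℕ} {Γ : Fin n → ℕ} {ψ : MetricFormula L n},
    ψ.IsPrenexUniversal → (supBlock Γ ψ).IsPrenexUniversal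
  | 0, _, _, h => h
  | _ + 1, Γ, ψ, h => isPrenexUniversal_supBlock (ψ := sup (Γ (Fin.last _)) ψ)
      (by simpa [IsPrenexUniversal] using h)

theorem isRestricted_supBlock {F : (b k : ℕ) → Set (Connective b k)} :
    ∀ {n : ℕ} {Γ : Fin n → ℕ} {ψ : MetricFormula L n},
    ψ.IsRestricted F → (supBlock Γ ψ).IsRestricted F
  | 0, _, _, h => h
  | _ + 1, Γ, ψ, h => isRestricted_supBlock (ψ := sup (Γ (Fin.last _)) ψ) h

theorem init_mem_domPi {M : MetricStructure.{u, v} L} {n : ℕ} {Γ : Fin (n + 1) → ℕ}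
    {x : Fin (n + 1) → M.carrier} (hx : x ∈ domPi M Γ) :
    Fin.init (α := fun _ => M.carrier) x ∈ domPi M (Fin.init (α := fun _ => ℕ) Γ) :=
  fun i => hx i.castSucc

theorem value_le_supBlock {M : MetricStructure.{u, v} L} (hM : M.IsProper) :
    ∀ {n : ℕ} {Γ : Fin n → ℕ} (ψ : MetricFormula L n) {x : Fin n → M.carrier},
      x ∈ domPi M Γ → ψ.value M x ≤ M.sentenceValue (supBlock Γ ψ)
  | 0, _, ψ, x, _ => (congrArg (ψ.value M) (Subsingleton.elim _ _)).le
  | n + 1, Γ, ψ, x, hx => by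
      have : CompactSpace (M.dom (Γ (Fin.last n))) := isCompact_iff_compactSpace.1 (hM _)
      refine le_trans ?_ (value_le_supBlock hM (sup (Γ (Fin.last n)) ψ) (init_mem_domPi hx))
      have hc := continuous_value_snoc_apply hM (D := Γ (Fin.last n)) ψ
        (Fin.init (α := fun _ => M.carrier) x)
      have := le_ciSup (isCompact_range hc).bddAbove ⟨x (Fin.last n), hx _⟩
      rwa [Fin.snoc_init_self] at this

/-- Compactness of the nonempty domains lets a maximizer be chosen one variable at a time. This is
the source of the witnesses in the target structure. -/
theorem exists_value_eq_supBlock {M : MetricStructure.{u, v} L} (hM : M.IsProper) :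
    ∀ {n : ℕ} (Γ : Fin n → ℕ) (ψ : MetricFormula L n),
      ∃ x ∈ domPi M Γ, ψ.value M x = M.sentenceValue (supBlock Γ ψ)
  | 0, _, ψ => ⟨fun i => i.elim0, fun i => i.elim0, rfl⟩
  | n + 1, Γ, ψ => by
      have : CompactSpace (M.dom (Γ (Fin.last n))) := isCompact_iff_compactSpace.1 (hM _)
      have : Nonempty (M.dom (Γ (Fin.last n))) := (M.dom_nonempty _).to_subtype
      obtain ⟨x, hx, hval⟩ := exists_value_eq_supBlock hM (Fin.init (α := fun _ => ℕ) Γ)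
        (sup (Γ (Fin.last n)) ψ)
      obtain ⟨a, -, ha⟩ := isCompact_univ.exists_sSup_image_eq univ_nonempty
        (continuous_value_snoc_apply hM (D := Γ (Fin.last n)) ψ x).continuousOn
      refine ⟨Fin.snoc (α := fun _ => M.carrier) x a.1, ?_, ?_⟩
      · have := snoc_mem_domPi hx a.2
        rwa [Fin.snoc_init_self] at this
      · rw [← ha, image_univ]
        exact hval

end MetricFormula

/-! ## Atoms with arbitrary variables -/

/-- Atomic formulas with variables from `X`. -/
abbrev MetricAtom (L : MetricLanguage.{u}) (X : Type v) : Type (max u v) :=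
  (X × X) ⊕ ((R : L.Rel) × (Fin (L.arity R) → X))

namespace MetricAtom

variable {L : MetricLanguage.{u}} {X : Type v}

/-- The value of an atom under an assignment. -/
def eval (M : MetricStructure.{u, w} L) (y : X → M.carrier) : MetricAtom L X → ℝ
  | .inl p => dist (y p.1) (y p.2)
  | .inr p => M.rel p.1 fun i => y (p.2 i)

/-- Substitution of variables in an atom. -/
def map {Y : Type w} (g : X → Y) : MetricAtom L X → MetricAtom L Y
  | .inl p => .inl (g p.1, g p.2)
  | .inr p => .inr ⟨p.1, fun i => g (p.2 i)⟩

/-- The variables of an atom. -/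
def vars : MetricAtom L X → Set X
  | .inl p => {p.1, p.2}
  | .inr p => range p.2

theorem finite_vars : ∀ A : MetricAtom L X, A.vars.Finite
  | .inl p => toFinite {p.1, p.2}
  | .inr _ => finite_range _

theorem eval_map {Y : Type w'} (M : MetricStructure.{u, w} L) (g : X → Y) (y : Y → M.carrier) :
    ∀ A : MetricAtom L X, (A.map g).eval M y = A.eval M (fun x => y (g x))
  | .inl _ => rfl
  | .inr _ => rfl

theorem eval_congr (M : MetricStructure.{u, w} L) {y z : X → M.carrier} :
    ∀ {A : MetricAtom L X}, (∀ x ∈ A.vars, y x = z x) → A.eval M y = A.eval M z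
  | .inl p, h => by rw [eval, eval, h p.1 (by simp [vars]), h p.2 (by simp [vars])]
  | .inr p, h => by simp only [eval, fun i => h (p.2 i) ⟨i, rfl⟩]

/-- An atom in the variables `x 0, …, x (n - 1)` as a formula. -/
def toFormula {n : ℕ} : MetricAtom L (Fin n) → MetricFormula L n
  | .inl p => .dist p.1 p.2
  | .inr p => .rel p.1 p.2

theorem value_toFormula (M : MetricStructure.{u, w} L) {n : ℕ} (x : Fin n → M.carrier) :
    ∀ A : MetricAtom L (Fin n), A.toFormula.value M x = A.eval M x
  | .inl _ => rfl
  | .inr _ => rfl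

theorem abs_eval_le (M : MetricStructure.{u, w} L) {n : ℕ} {Γ : Fin n → ℕ} {x : Fin n → M.carrier}
    (hx : x ∈ MetricFormula.domPi M Γ) :
    ∀ A : MetricAtom L (Fin n), |A.eval M x| ≤ A.toFormula.bound Γ
  | .inl p => by
      rw [eval, abs_of_nonneg dist_nonneg]
      exact M.dist_le _ _ _ _ (hx _) (hx _)
  | .inr p => M.rel_le _ _ _ fun i => hx (p.2 i)

theorem wellFormed_toFormula {n : ℕ} (Γ : Fin n → ℕ) :
    ∀ A : MetricAtom L (Fin n), A.toFormula.WellFormed Γ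
  | .inl _ => trivial
  | .inr _ => trivial

theorem isRestricted_toFormula {n : ℕ} (F : (b k : ℕ) → Set (Connective b k)) :
    ∀ A : MetricAtom L (Fin n), A.toFormula.IsRestricted F
  | .inl _ => trivial
  | .inr _ => trivial

theorem isQuantifierFree_toFormula {n : ℕ} :
    ∀ A : MetricAtom L (Fin n), A.toFormula.IsQuantifierFree
  | .inl _ => trivial
  | .inr _ => trivial

/-- The moduli control a relation only on products of domains, so each variable is confined to a
fixed domain `q x`. -/
theorem continuous_eval (M : MetricStructure.{u, w} L) (q : X → ℕ) :
    ∀ A : MetricAtom L X, Continuous fun y : (x : X) → M.dom (q x) => A.eval M fun x => (y x).1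
  | .inl p => by
      simp only [eval]
      fun_prop
  | .inr p => by
      simp only [eval]
      exact (MetricFormula.continuousOn_rel M p.1 fun i => q (p.2 i)).comp_continuous
        (by fun_prop) fun y i => (y (p.2 i)).2

end MetricAtom

/-- The connective `t ↦ -∑ i, |t i - r i|`, truncated to `[-b, b]`. -/
noncomputable def deviationConnective (b k : ℕ) (r : Fin k → ℝ) : Connective b k where
  toFun t := Set.projIcc (-(b : ℝ)) (b : ℝ) (by simp) (-∑ i, |(t i : ℝ) - r i|)
  continuous_toFun := by
    refine Continuous.comp continuous_projIcc (g := Set.projIcc (-(b : ℝ)) (b : ℝ) (by simp))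
      (f := fun t : Fin k → Set.Icc (-(b : ℝ)) (b : ℝ) => -∑ i, |(t i : ℝ) - r i|) ?_
    fun_prop

theorem deviationConnective_self {b k : ℕ} {r : Fin k → ℝ}
    {t : Fin k → Set.Icc (-(b : ℝ)) (b : ℝ)} (h : ∀ i, (t i : ℝ) = r i) :
    (deviationConnective b k r t : ℝ) = 0 := by
  simp [deviationConnective, h, coe_projIcc]

theorem abs_sub_le_of_lt_deviationConnective {b k : ℕ} {r : Fin k → ℝ}
    {t : Fin k → Set.Icc (-(b : ℝ)) (b : ℝ)} {ε : ℝ} (hε : ε ≤ b)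
    (h : -ε < deviationConnective b k r t) (i : Fin k) : |(t i : ℝ) - r i| ≤ ε := by
  have h1 : -ε < max (-(b : ℝ)) (min (b : ℝ) (-∑ i, |(t i : ℝ) - r i|)) := by
    simpa only [deviationConnective, ContinuousMap.coe_mk, coe_projIcc] using h
  rcases lt_max_iff.1 h1 with h2 | h2
  -- Truncation at `-b` cannot have taken effect, because `ε ≤ b`.
  · linarith
  · have h3 := Finset.single_le_sum (f := fun i => |(t i : ℝ) - r i|)
      (fun i _ => abs_nonneg _) (Finset.mem_univ i)
    have h4 := (lt_min_iff.1 h2).2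
    linarith

/-! ### From values of sentences to embeddings -/

namespace MetricStructure

variable {L : MetricLanguage.{u}} {F : (b k : ℕ) → Set (Connective b k)}
  {M : MetricStructure.{u, v} L} {N : MetricStructure.{u, w} L}

/-- If no restricted prenex universal sentence has a larger value in `M` than in `N`, then every
finite part of the atomic diagram of a tuple in `M` is approximately realized in `N`. -/
theorem exists_tuple_of_sentenceValue_le (hF : UniformlyDense F) (hM : M.IsProper)
    (hN : N.IsProper)
    (hMN : ∀ φ ∈ restrictedPrenexUniversalSentences L F, M.sentenceValue φ ≤ N.sentenceValue φ)
    {n k : ℕ} {Γ : Fin n → ℕ} (A : Fin k → MetricAtom L (Fin n)) {x : Fin n → M.carrier}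
    (hx : x ∈ MetricFormula.domPi M Γ) {ε : ℝ} (hε : 0 < ε) :
    ∃ y ∈ MetricFormula.domPi N Γ, ∀ j, |(A j).eval N y - (A j).eval M x| ≤ ε := by
  -- The sum makes the connective applicable to all atoms; the summand `ε` keeps its truncation
  -- harmless.
  obtain ⟨b, hb⟩ := exists_nat_ge (ε + ∑ j, |(A j).toFormula.bound Γ|)
  have hsum : 0 ≤ ∑ j, |(A j).toFormula.bound Γ| := Finset.sum_nonneg fun _ _ => abs_nonneg _
  have hbound : ∀ j, (A j).toFormula.bound Γ ≤ b := fun j => by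
    have := Finset.single_le_sum (f := fun j => |(A j).toFormula.bound Γ|)
      (fun j _ => abs_nonneg _) (Finset.mem_univ j)
    have := le_abs_self ((A j).toFormula.bound Γ)
    linarith
  let g := deviationConnective b k fun j => (A j).eval M x
  -- The error `ε / 2` is spent twice: on passing from `g` to `f` at `x`, where `g` contributes 0,
  -- and on returning from `f` to `g` at `y`.
  obtain ⟨f, hf, hfg⟩ := hF b k g (ε / 2) (half_pos hε)
  let ψ : MetricFormula L n := .conn b k f fun j => (A j).toFormula
  have hψ : MetricFormula.supBlock Γ ψ ∈ restrictedPrenexUniversalSentences L F :=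
    ⟨MetricFormula.wellFormed_supBlock fun j => ⟨hbound j, (A j).wellFormed_toFormula Γ⟩,
      MetricFormula.isRestricted_supBlock ⟨hf, fun j => (A j).isRestricted_toFormula F⟩,
      MetricFormula.isPrenexUniversal_supBlock
        (MetricFormula.IsQuantifierFree.isPrenexUniversal
          fun j => (A j).isQuantifierFree_toFormula)⟩
  have hproj : ∀ s : ℝ, |s| ≤ b → (projIcc (-(b : ℝ)) (b : ℝ) (by simp) s : ℝ) = s :=
    fun s hs => by rw [projIcc_of_mem _ (abs_le.1 hs)]
  obtain ⟨y, hy, hval⟩ := MetricFormula.exists_value_eq_supBlock hN Γ ψ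
  refine ⟨y, hy, fun j => ?_⟩
  have h1 : -(ε / 2) < ψ.value M x := by
    have h2 := hfg fun j => projIcc (-(b : ℝ)) (b : ℝ) (by simp) ((A j).toFormula.value M x)
    rw [deviationConnective_self fun j => ?_, sub_zero] at h2
    · exact (abs_lt.1 h2).1
    · rw [MetricAtom.value_toFormula]
      exact hproj _ (((A j).abs_eval_le M hx).trans (hbound j))
  have h3 : -(ε / 2) < ψ.value N y :=
    h1.trans_le ((MetricFormula.value_le_supBlock hM ψ hx).trans ((hMN _ hψ).trans hval.ge))
  have h4 := hfg fun j => projIcc (-(b : ℝ)) (b : ℝ) (by simp) ((A j).toFormula.value N y)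
  have h5 : -ε < g fun j => projIcc (-(b : ℝ)) (b : ℝ) (by simp) ((A j).toFormula.value N y) := by
    have := (abs_lt.1 h4).2
    simp only [ψ, MetricFormula.value] at h3
    linarith
  have h6 := abs_sub_le_of_lt_deviationConnective (by linarith) h5 j
  rwa [MetricAtom.value_toFormula, hproj _ (((A j).abs_eval_le N hy).trans (hbound j))] at h6

/-- The approximate realization of finitely many atoms with parameters from `M`. -/
theorem exists_assignment_of_sentenceValue_le (hF : UniformlyDense F) (hM : M.IsProper)
    (hN : N.IsProper)
    (hMN : ∀ φ ∈ restrictedPrenexUniversalSentences L F, M.sentenceValue φ ≤ N.sentenceValue φ)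
    {q : M.carrier → ℕ} (hq : ∀ x, x ∈ M.dom (q x)) (s : Finset (MetricAtom L M.carrier))
    {ε : ℝ} (hε : 0 < ε) :
    ∃ y : (x : M.carrier) → N.dom (q x),
      ∀ A ∈ s, |A.eval N (fun x => (y x).1) - A.eval M id| ≤ ε := by
  classical
  obtain ⟨x₀, -⟩ := M.dom_nonempty 0
  -- Including `x₀` keeps `T` nonempty, so `idx` has a default value.
  let T : Set M.carrier := insert x₀ (⋃ A ∈ s, A.vars)
  have hT : Finite T := ((s.finite_toSet.biUnion fun A _ => A.finite_vars).insert x₀).to_subtype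
  obtain ⟨n, ⟨e⟩⟩ := Finite.exists_equiv_fin T
  let p : Fin n → M.carrier := fun i => (e.symm i).1
  let idx : M.carrier → Fin n := fun x => if h : x ∈ T then e ⟨x, h⟩ else e ⟨x₀, mem_insert _ _⟩
  have hidx : ∀ x ∈ T, p (idx x) = x := fun x hx => by simp [p, idx, hx]
  have hvars : ∀ A ∈ s, ∀ x ∈ A.vars, p (idx x) = x := fun A hA x hx =>
    hidx x (mem_insert_of_mem _ (mem_biUnion hA hx))
  obtain ⟨y, hy, hyA⟩ := exists_tuple_of_sentenceValue_le hF hM hN hMN (Γ := fun i => q (p i))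
    (fun j => ((s.equivFin.symm j).1).map idx) (x := p) (fun i => hq (p i)) hε
  -- The test `p (idx x) = x` also guarantees that `y (idx x)` lies in the domain `q x`. Other
  -- elements occur in no atom of `s` and get arbitrary values.
  refine ⟨fun x => if h : p (idx x) = x then ⟨y (idx x), by simpa [h] using hy (idx x)⟩
    else ⟨_, (N.dom_nonempty (q x)).some_mem⟩, fun A hA => ?_⟩
  have h1 := hyA (s.equivFin ⟨A, hA⟩)
  simp only [Equiv.symm_apply_apply, MetricAtom.eval_map] at h1
  rw [MetricAtom.eval_congr M (z := id) (hvars A hA)] at h1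
  rwa [MetricAtom.eval_congr N (z := fun x => y (idx x))]
  intro x hx
  simp [hvars A hA x hx]

/-- Assignments form a product of compact domains, so the diagrams they realize form a compact,
hence closed, set. The diagram of M is a limit of such diagrams and therefore belongs to it.
Distance atoms then give an isometry, relation atoms the preservation of relations. -/
theorem exists_embedding_of_sentenceValue_le (hF : UniformlyDense F) (hM : M.IsProper)
    (hN : N.IsProper) (hmono : Monotone N.dom)
    (hMN : ∀ φ ∈ restrictedPrenexUniversalSentences L F, M.sentenceValue φ ≤ N.sentenceValue φ) :
    ∃ e, M.IsEmbedding N e := by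
  classical
  -- The least index is chosen so that, by monotonicity of `N.dom`, the image of `x` lies in every
  -- domain required of it.
  let q : M.carrier → ℕ := fun x => Nat.find (M.dom_cover x)
  have hq : ∀ x, x ∈ M.dom (q x) := fun x => Nat.find_spec (M.dom_cover x)
  have hcomp : ∀ x, CompactSpace (N.dom (q x)) := fun x => isCompact_iff_compactSpace.1 (hN _)
  let V : ((x : M.carrier) → N.dom (q x)) → MetricAtom L M.carrier → ℝ :=
    fun y A => A.eval N fun x => (y x).1
  have hV : Continuous V := continuous_pi fun A => A.continuous_eval N q
  choose Y hY using fun p : Finset (MetricAtom L M.carrier) × ℕ =>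
    exists_assignment_of_sentenceValue_le hF hM hN hMN hq p.1
      (show (0 : ℝ) < 1 / ((p.2 : ℝ) + 1) by positivity)
  -- Only the diagrams `V (Y p)` converge, along larger finite sets of atoms and smaller errors; the
  -- assignments `Y p` need not.
  have hlim : Filter.Tendsto (fun p => V (Y p)) Filter.atTop (𝓝 fun A => A.eval M id) := by
    refine tendsto_pi_nhds.2 fun A => Metric.tendsto_atTop.2 fun ε hε => ?_
    obtain ⟨m, hm⟩ := exists_nat_one_div_lt hε
    refine ⟨({A}, m), fun p hp => ?_⟩
    rw [Real.dist_eq]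
    have h1 := hY p A (hp.1 (Finset.mem_singleton_self A))
    have h2 : 1 / ((p.2 : ℝ) + 1) ≤ 1 / ((m : ℝ) + 1) := by
      have : (m : ℝ) ≤ p.2 := by exact_mod_cast hp.2
      gcongr
    exact (h1.trans h2).trans_lt hm
  obtain ⟨y, hy⟩ := (isCompact_range hV).isClosed.mem_of_tendsto hlim
    (Filter.Eventually.of_forall fun p => mem_range_self (Y p))
  refine ⟨fun x => (y x).1, Isometry.of_dist_eq fun a b => congrFun hy (.inl (a, b)),
    fun n x hx => ?_, fun R x => congrFun hy (.inr ⟨R, x⟩)⟩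
  exact hmono (Nat.find_min' (M.dom_cover x) hx) (y x).2

theorem isomorphic_of_sentenceValue_eq {M N : MetricStructure.{u, v} L} (hF : UniformlyDense F)
    (hM : M.IsProper) (hN : N.IsProper) (hMmono : Monotone M.dom) (hNmono : Monotone N.dom)
    (hMN : ∀ φ ∈ restrictedPrenexUniversalSentences L F, M.sentenceValue φ = N.sentenceValue φ) :
    M.Isomorphic N := by
  obtain ⟨e, he⟩ := exists_embedding_of_sentenceValue_le hF hM hN hNmono fun φ h => (hMN φ h).le
  obtain ⟨e', he'⟩ := exists_embedding_of_sentenceValue_le hF hN hM hMmono fun φ h => (hMN φ h).ge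
  exact isomorphic_of_embeddings hM he he'

end MetricStructure

/-! ## The isomorphism relation -/

section Isomorphism

variable {L : MetricLanguage.{u}} {E : Exhaustion}

theorem equivalence_properIsomorphism (L : MetricLanguage.{u}) (E : Exhaustion) :
    Equivalence (properIsomorphism L E) :=
  ⟨fun _ => .refl _, fun h => h.symm, fun h h' => h.trans h'⟩

/-- Values of all sentences are isomorphism invariants, and the prenex ones already suffice for the
converse. Any list containing these therefore works, which covers both families of sentences. -/
theorem isBorelReduction_sentenceValue {F : (b k : ℕ) → Set (Connective b k)}
    (hF : UniformlyDense F) {φ : ℕ → MetricFormula L 0}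
    (hφ : restrictedPrenexUniversalSentences L F ⊆ range φ) :
    IsBorelReduction (properIsomorphism L E) (fun s t : ℕ → ℝ => s = t)
      (fun f n => (structureOfCode f).sentenceValue (φ n)) := by
  refine ⟨measurable_pi_lambda _ fun n => MetricFormula.measurable_sentenceValue (φ n),
    fun f g => ⟨fun h => funext fun n => h.sentenceValue_eq (φ n), fun h => ?_⟩⟩
  refine MetricStructure.isomorphic_of_sentenceValue_eq hF (isProper_structureOfCode f)
    (isProper_structureOfCode g) (isCode_of_mem_properCodes f).monotone_dom
    (isCode_of_mem_properCodes g).monotone_dom fun ψ hψ => ?_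
  obtain ⟨n, rfl⟩ := hφ hψ
  exact congrFun h n

end Isomorphism

theorem mainTheorem7 (L : MetricLanguage.{u}) [Countable L.Rel] (E : Exhaustion)
    (F : (b k : ℕ) → Set (Connective b k)) (hFcount : ∀ b k, (F b k).Countable)
    (hFdense : UniformlyDense F) :
    MeasurableSet (codes L E) ∧ MeasurableSet (properCodes L E) ∧
    IsSmooth (properIsomorphism L E) ∧
    ∀ S : Set (MetricFormula L 0),
      (S = restrictedUniversalSentences L F ∨ S = restrictedPrenexUniversalSentences L F) →
      (∃ φ : ℕ → MetricFormula L 0, Set.range φ = S) ∧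
      ∀ φ : ℕ → MetricFormula L 0, Set.range φ = S →
        IsBorelReduction (properIsomorphism L E) (fun s t : ℕ → ℝ => s = t)
          (fun f n => (structureOfCode f).sentenceValue (φ n)) := by
  have hsub : ∀ S : Set (MetricFormula L 0),
      (S = restrictedUniversalSentences L F ∨ S = restrictedPrenexUniversalSentences L F) →
      restrictedPrenexUniversalSentences L F ⊆ S ∧ S ⊆ restrictedUniversalSentences L F := by
    rintro S (rfl | rfl)
    · exact ⟨restrictedPrenexUniversalSentences_subset L F, Subset.rfl⟩
    · exact ⟨Subset.rfl, restrictedPrenexUniversalSentences_subset L F⟩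
  have henum : ∀ S : Set (MetricFormula L 0),
      (S = restrictedUniversalSentences L F ∨ S = restrictedPrenexUniversalSentences L F) →
      ∃ φ : ℕ → MetricFormula L 0, Set.range φ = S := fun S hS => by
    obtain ⟨φ, hφ⟩ := ((countable_restrictedUniversalSentences hFcount).mono
      (hsub S hS).2).exists_eq_range
        ((nonempty_restrictedPrenexUniversalSentences L hFdense).mono (hsub S hS).1)
    exact ⟨φ, hφ.symm⟩
  have hproper := measurableSet_properCodes L E
  refine ⟨measurableSet_codes L E, hproper,
    ⟨hproper.standardBorel, equivalence_properIsomorphism L E, ?_⟩, fun S hS =>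
    ⟨henum S hS, fun φ hφ => isBorelReduction_sentenceValue hFdense (hφ ▸ (hsub S hS).1)⟩⟩
  obtain ⟨φ, hφ⟩ := henum _ (.inr rfl)
  -- An injective Borel map into `ℝ` turns the sequence of values into a single real invariant.
  obtain ⟨g, hg⟩ := MeasureTheory.exists_measurableEmbedding_real (ℕ → ℝ)
  obtain ⟨hmeas, hred⟩ := isBorelReduction_sentenceValue (E := E) hFdense hφ.ge
  exact ⟨_, hg.measurable.comp hmeas, fun f f' => (hred f f').trans hg.injective.eq_iff.symm⟩
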